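/- Let $n\ge 2$, let $u\in\mathbb{R}^n$ be a unit vector, and let $H=u^{\perp}$ be oriented so that $u$ lies in the closed half-space $H^+=\{x: x\cdot u\ge 0\}$; put $H^-=\{x:x\cdot u\le 0\}$. Let $x^{\dagger}$ and $A^{\dagger}$ denote the reflections in $H$ of a point $x$ and of a set $A$. Let $\mathcal{K}^n$ be the class of nonempty compact convex subsets of $\mathbb{R}^n$, $\mathcal{K}^n_n$ the class of those with nonempty interior, and $\mathcal{L}^n$ the class of Lebesgue measurable subsets of $\mathbb{R}^n$ of finite measure. "Essentially" means up to Lebesgue null sets, and $B(x,r)$ is the closed ball with center $x$ and radius $r$. For $A\subset\mathbb{R}^n$ let $\Diamond_{P_H}A=\{x: (P_H1_A)(x)=1\}$, where $P_Hf(x)=\max\{f(x),f(x^\dagger)\}$ if $x\in H^+$ and $P_Hf(x)=\min\{f(x),f(x^\dagger)\}$ if $x\in H^-$, and let $\Diamond_{P_H}^{\dagger}A=(\Diamond_{P_H}A)^{\dagger}$. Let $\mathcal{E}=\mathcal{K}^n_n$ or $\mathcal{E}=\mathcal{K}^n$, and suppose that $\Diamond:\mathcal{E}\to\mathcal{L}^n$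 has the following properties for all $K,L\in\mathcal{E}$, where all inclusions and equalities of sets are understood essentially: - (monotonic) $K\subset L$ implies $\Diamond K\subset\Diamond L$; - (measure preserving) $\Diamond K$ and $K$ have the same measure; - (respects $H$-cylinders) if $x\in\mathbb{R}^n$, $r>0$ and $K\subset (B(x,r)\cap H)+H^{\perp}$, then $\Diamond K\subset (B(x,r)\cap H)+H^{\perp}$; - (maps balls to balls) if $K=B(x,r)$ with $r>0$, then $\Diamond K=B(x',r')$ for some $x'\in\mathbb{R}^n$ and $r'>0$. Then there is a unique function $\varphi_{\Diamond}:\mathbb{R}\to\mathbb{R}$ that is Lipschitz with constant $1$ and satisfies $\Diamond B(x+tu,r)=B(x+\varphi_{\Diamond}(t)u,r)$, essentially, for all $x\in H$, $t\in\mathbb{R}$ and $r>0$. Moreover: 1. $\varphi_{\Diamond}(t)=t$ for all $t\in\mathbb{R}$ if and only if $\Diamond K=K$, essentially, for every $K\in\mathcal{E}$; 2. $\varphi_{\Diamond}(t)=-t$ for all $t\in\mathbb{R}$ if and only if $\Diamond K=K^{\dagger}$, essentially, for every $K\in\mathcal{E}$; 3. $\varphi_{\Diamond}(t)=|t|$ for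 all $t\in\mathbb{R}$ if and only if $\Diamond K=\Diamond_{P_H}K$, essentially, for every $K\in\mathcal{E}$; 4. $\varphi_{\Diamond}(t)=-|t|$ for all $t\in\mathbb{R}$ if and only if $\Diamond K=\Diamond_{P_H}^{\dagger}K$, essentially, for every $K\in\mathcal{E}$. -/

import Mathlib

open MeasureTheory
open scoped Pointwise

noncomputable section

namespace Polarization

/-- Euclidean `n`-space. -/
abbrev Euc (n : ℕ) : Type := EuclideanSpace ℝ (Fin n)

/-- Nonempty compact convex subsets of `ℝⁿ`. -/
def compactConvexSets (n : ℕ) : Set (Set (Euc n)) :=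
  {K | K.Nonempty ∧ IsCompact K ∧ Convex ℝ K}

/-- Convex bodies: nonempty compact convex sets with interior points. -/
def convexBodies (n : ℕ) : Set (Set (Euc n)) :=
  {K | K ∈ compactConvexSets n ∧ (interior K).Nonempty}

/-- Lebesgue measurable subsets of `ℝⁿ` of finite measure. -/
def finiteMeasureSets (n : ℕ) : Set (Set (Euc n)) :=
  {A | NullMeasurableSet A volume ∧ volume A < ⊤}

/-- The hyperplane `H = u^⊥`. -/
abbrev hyperplane {n : ℕ} (u : Euc n) : Submodule ℝ (Euc n) := (Submodule.span ℝ {u})ᗮ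

/-- The reflection `A†` of the set `A` in the subspace `H`. -/
def reflectSet {n : ℕ} (H : Submodule ℝ (Euc n)) (A : Set (Euc n)) : Set (Euc n) :=
  H.reflection '' A

/-- Polarization `P_H f` of a function `f`, where `H = u^⊥` is oriented with `u ∈ H⁺`. On `H`
itself `x† = x`, so both branches agree there. -/
def polarize {n : ℕ} (u : Euc n) (f : Euc n → ℝ) (x : Euc n) : ℝ :=
  if 0 ≤ inner ℝ u x then max (f x) (f ((hyperplane u).reflection x))
  else min (f x) (f ((hyperplane u).reflection x))

/-- The set map induced by polarization: `A ↦ {x | (P_H 1_A)(x) = 1}`. -/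
def polarizeSet {n : ℕ} (u : Euc n) (A : Set (Euc n)) : Set (Euc n) :=
  {x | polarize u (A.indicator (fun _ => (1 : ℝ))) x = 1}

section Properties

variable {n : ℕ} {𝓔 : Set (Set (Euc n))}

/-- `K ⊆ L ⇒ D K ⊆ D L`, inclusions up to null sets. -/
def IsMonotonic (D : 𝓔 → finiteMeasureSets n) : Prop :=
  ∀ K L : 𝓔, (K : Set (Euc n)) ≤ᵐ[volume] (L : Set (Euc n)) →
    (D K : Set (Euc n)) ≤ᵐ[volume] (D L : Set (Euc n))

def IsMeasurePreserving (D : 𝓔 → finiteMeasureSets n) : Prop :=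
  ∀ K : 𝓔, volume (D K : Set (Euc n)) = volume (K : Set (Euc n))

/-- If `K ⊆ (B(x,r) ∩ H) + H^⊥`, then `D K ⊆ (B(x,r) ∩ H) + H^⊥`, up to null sets. -/
def RespectsCylinders (H : Submodule ℝ (Euc n)) (D : 𝓔 → finiteMeasureSets n) : Prop :=
  ∀ (K : 𝓔) (x : Euc n) (r : ℝ), 0 < r →
    (K : Set (Euc n)) ≤ᵐ[volume]
      ((Metric.closedBall x r ∩ (H : Set (Euc n))) + (Hᗮ : Set (Euc n)) : Set (Euc n)) →
    (D K : Set (Euc n)) ≤ᵐ[volume]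
      ((Metric.closedBall x r ∩ (H : Set (Euc n))) + (Hᗮ : Set (Euc n)) : Set (Euc n))

/-- The image of every ball is a ball, up to null sets. -/
def MapsBallsToBalls (D : 𝓔 → finiteMeasureSets n) : Prop :=
  ∀ (K : 𝓔) (x : Euc n) (r : ℝ), 0 < r →
    (K : Set (Euc n)) =ᵐ[volume] Metric.closedBall x r →
    ∃ (x' : Euc n) (r' : ℝ), 0 < r' ∧
      (D K : Set (Euc n)) =ᵐ[volume] Metric.closedBall x' r'

/-- `φ` is a contraction with `D B(x + t u, r) = B(x + φ(t) u, r)` up to null sets, for all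
`r > 0`, `x ∈ H = u^⊥` and `t ∈ ℝ`. -/
def IsShiftFunction (u : Euc n) (D : 𝓔 → finiteMeasureSets n) (φ : ℝ → ℝ) : Prop :=
  LipschitzWith 1 φ ∧
    ∀ (K : 𝓔) (x : Euc n) (t r : ℝ), x ∈ hyperplane u → 0 < r →
      (K : Set (Euc n)) = Metric.closedBall (x + t • u) r →
      (D K : Set (Euc n)) =ᵐ[volume] Metric.closedBall (x + φ t • u) r

/-- `D` agrees with the set map `F` up to null sets (the null set may depend on the argument). -/
def EssentiallyEquals (D : 𝓔 → finiteMeasureSets n) (F : Set (Euc n) → Set (Euc n)) : Prop :=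
  ∀ K : 𝓔, (D K : Set (Euc n)) =ᵐ[volume] F K

end Properties

end Polarization

end

/-!
Cylinders and measure preservation confine `D B(x + tu, r)` to a ball `B(x + su, r)` on the same
axis. If two balls at height `t` are tangent internally, their images are still nested, and the
offset of the centres along `H` is already the difference of the radii; this leaves no room for
different values of `s`. Comparing balls through such tangencies gives `s = φ t`, where `φ t`
depends on `t` only.

Let `C` be a thin solid cylinder of radius `δ` and half-height `h` around a segment parallel to `u`
with midpoint `x + mu`, inside `int K`. Then `C` lies in a cylinder parallel to `u` of radius `δ`
and in a ball centred at `x + mu` whose radius exceeds `h` by `O(δ²)`, so `D C` lies in the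
cylinder `C'` around `x + φ(m)u` that is only `O(δ²)` taller than `C`. As `D C` and `C` have the
same volume, `D C` misses a volume `O(δ²) δ^(n-1)` of `C'`, which is negligible against the volume
`δ^n` of a ball of radius `δ`. So all points of the segment translated by `(φ m - m)u` are density
points of `D K`. For each of the four functions `φ` these translated segments cover the candidate
set, whose volume is at least that of `K`, so `D K` is that set.
-/

namespace Polarization

open Metric Set Filter Topology Submodule
open scoped RealInnerProductSpace

section Balls

variable {E : Type*} [NormedAddCommGroup E] [NormedSpace ℝ E] {a b : E} {r s : ℝ}

theorem dist_le_sub_of_closedBall_subset (hr : 0 ≤ r) (hrs : r ≤ s)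
    (h : closedBall a r ⊆ closedBall b s) : dist a b ≤ s - r := by
  rcases eq_or_ne a b with rfl | hab
  · simpa using hrs
  have hne : a - b ≠ 0 := sub_ne_zero.2 hab
  set e : E := ‖a - b‖⁻¹ • (a - b) with he_def
  have he : ‖e‖ = 1 := norm_smul_inv_norm hne
  have hfar : a + r • e ∈ closedBall b s := h (by simp [norm_smul, he, abs_of_nonneg hr])
  have hdiff : a + r • e - b = (‖a - b‖ + r) • e := by
    rw [add_smul, he_def, smul_inv_smul₀ (norm_ne_zero_iff.2 hne)]
    abel
  rw [mem_closedBall, dist_eq_norm, hdiff, norm_smul, he, mul_one, Real.norm_eq_abs,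
    abs_of_nonneg (by positivity)] at hfar
  rw [dist_eq_norm]
  linarith

variable [MeasurableSpace E] {μ : Measure E}

theorem closedBall_subset_of_ae_le [OpensMeasurableSpace E] [μ.IsOpenPosMeasure] {S : Set E}
    (hr : 0 < r) (hS : IsClosed S) (h : closedBall a r ≤ᵐ[μ] S) : closedBall a r ⊆ S := by
  have hnull : μ (ball a r \ S) = 0 :=
    measure_mono_null (sdiff_subset_sdiff_left ball_subset_closedBall) (ae_le_set.1 h)
  have hempty : ball a r \ S = ∅ := (isOpen_ball.sdiff hS).measure_eq_zero_iff μ |>.1 hnull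
  rw [← closure_ball a hr.ne']
  exact closure_minimal (sdiff_eq_empty.1 hempty) hS

theorem dist_le_sub_of_closedBall_ae_le [OpensMeasurableSpace E] [μ.IsOpenPosMeasure]
    (hr : 0 < r) (hrs : r ≤ s) (h : closedBall a r ≤ᵐ[μ] closedBall b s) : dist a b ≤ s - r :=
  dist_le_sub_of_closedBall_subset hr.le hrs (closedBall_subset_of_ae_le hr isClosed_closedBall h)

theorem radius_eq_of_addHaar_closedBall_eq [BorelSpace E] [FiniteDimensional ℝ E] [Nontrivial E]
    [μ.IsAddHaarMeasure] (hr : 0 ≤ r) (hs : 0 ≤ s)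
    (h : μ (closedBall a r) = μ (closedBall b s)) : r = s := by
  rw [Measure.addHaar_closedBall _ _ hr, Measure.addHaar_closedBall _ _ hs,
    ENNReal.mul_left_inj (measure_ball_pos μ _ one_pos).ne' measure_ball_lt_top.ne,
    ENNReal.ofReal_eq_ofReal_iff (by positivity) (by positivity)] at h
  exact (pow_left_inj₀ hr hs Module.finrank_pos.ne').1 h

end Balls

section Coordinates

variable {E : Type*} [NormedAddCommGroup E] [InnerProductSpace ℝ E] {u x : E}

theorem exists_eq_add_smul (u z : E) : ∃ x ∈ (ℝ ∙ u)ᗮ, ∃ t : ℝ, z = x + t • u := by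
  obtain ⟨y, hy, x, hx, rfl⟩ := (ℝ ∙ u).exists_add_mem_mem_orthogonal z
  obtain ⟨t, rfl⟩ := mem_span_singleton.1 hy
  exact ⟨x, hx, t, add_comm _ _⟩

theorem starProjection_add_smul (hx : x ∈ (ℝ ∙ u)ᗮ) (t : ℝ) :
    (ℝ ∙ u)ᗮ.starProjection (x + t • u) = x := by
  rw [map_add, map_smul, starProjection_orthogonalComplement_singleton_eq_zero, smul_zero,
    add_zero, starProjection_eq_self_iff.2 hx]

theorem inner_add_smul (hu : ‖u‖ = 1) (hx : x ∈ (ℝ ∙ u)ᗮ) (t : ℝ) : ⟪u, x + t • u⟫ = t := by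
  rw [inner_add_right, inner_smul_right, real_inner_self_eq_norm_sq, hu,
    mem_orthogonal_singleton_iff_inner_right.1 hx]
  ring

theorem norm_sq_add_smul (hu : ‖u‖ = 1) (hx : x ∈ (ℝ ∙ u)ᗮ) (t : ℝ) :
    ‖x + t • u‖ ^ 2 = ‖x‖ ^ 2 + t ^ 2 := by
  have hxu : ⟪x, t • u⟫ = 0 := by
    rw [inner_smul_right, mem_orthogonal_singleton_iff_inner_left.1 hx, mul_zero]
  rw [norm_add_sq_real, hxu, norm_smul, hu, Real.norm_eq_abs, mul_one, sq_abs]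
  ring

theorem reflection_add_smul (hx : x ∈ (ℝ ∙ u)ᗮ) (t : ℝ) :
    (ℝ ∙ u)ᗮ.reflection (x + t • u) = x + (-t) • u := by
  rw [map_add, map_smul, reflection_mem_subspace_eq_self hx,
    reflection_orthogonalComplement_singleton_eq_neg, smul_neg, neg_smul]

theorem inner_reflection (u z : E) : ⟪u, (ℝ ∙ u)ᗮ.reflection z⟫ = -⟪u, z⟫ := by
  rw [← LinearIsometryEquiv.inner_map_map (ℝ ∙ u)ᗮ.reflection, reflection_reflection,
    reflection_orthogonalComplement_singleton_eq_neg, inner_neg_left]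

theorem exists_mem_orthogonal_singleton_norm_eq (hE : 1 < Module.finrank ℝ E) (u : E) {c : ℝ}
    (hc : 0 ≤ c) : ∃ v ∈ (ℝ ∙ u)ᗮ, ‖v‖ = c := by
  have : FiniteDimensional ℝ E := .of_finrank_pos (zero_lt_one.trans hE)
  have hspan : Module.finrank ℝ (ℝ ∙ u) ≤ 1 := by
    simpa using finrank_span_le_card (R := ℝ) ({u} : Set E)
  have : Nontrivial (ℝ ∙ u)ᗮ := by
    have := finrank_add_finrank_orthogonal (ℝ ∙ u)
    exact Module.nontrivial_of_finrank_pos (R := ℝ) (by omega)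
  obtain ⟨v, hv⟩ := exists_norm_eq (ℝ ∙ u)ᗮ hc
  exact ⟨v, v.2, hv⟩

theorem inter_add_orthogonal_eq_preimage (H : Submodule ℝ E) [H.HasOrthogonalProjection]
    (S : Set E) : S ∩ (H : Set E) + (Hᗮ : Set E) = H.starProjection ⁻¹' S := by
  ext z
  constructor
  · rintro ⟨x, ⟨hxS, hxH⟩, y, hy, rfl⟩
    rwa [mem_preimage, map_add, starProjection_eq_self_iff.2 hxH,
      (starProjection_apply_eq_zero_iff H).2 hy, add_zero]
  · exact fun hz => ⟨_, ⟨hz, starProjection_apply_mem H z⟩, _,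
      sub_starProjection_mem_orthogonal z, add_sub_cancel _ _⟩

theorem starProjection_eq_of_closedBall_subset_preimage {H : Submodule ℝ E}
    [H.HasOrthogonalProjection] {c : E} {r : ℝ} (hx : x ∈ H) (hr : 0 ≤ r)
    (h : closedBall c r ⊆ H.starProjection ⁻¹' closedBall x r) : H.starProjection c = x := by
  have hsub : closedBall (H.orthogonalProjectionOnto c) r ⊆ closedBall (⟨x, hx⟩ : H) r := by
    intro w hw
    have hmem : c + (w - H.starProjection c) ∈ closedBall c r := by
      rw [mem_closedBall, dist_eq_norm] at hw ⊢
      rwa [add_sub_cancel_left]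
    have := h hmem
    rwa [mem_preimage, map_add, map_sub, starProjection_eq_self_iff.2 w.2,
      starProjection_eq_self_iff.2 (starProjection_apply_mem H c), add_sub_cancel] at this
  have hdist := dist_le_sub_of_closedBall_subset hr le_rfl hsub
  rw [sub_self, dist_le_zero] at hdist
  exact congrArg Subtype.val hdist

end Coordinates

section ShiftFunction

variable {n : ℕ} {u x y : Euc n} {𝓔 : Set (Set (Euc n))} {D : 𝓔 → finiteMeasureSets n}
  {r R t t' s s' : ℝ}

theorem closedBall_mem_convexBodies (c : Euc n) (hr : 0 < r) : closedBall c r ∈ convexBodies n :=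
  ⟨⟨⟨c, mem_closedBall_self hr.le⟩, isCompact_closedBall c r, convex_closedBall c r⟩,
    ⟨c, ball_subset_interior_closedBall (mem_ball_self hr)⟩⟩

theorem IsMonotonic.ae_le_of_subset (hmono : IsMonotonic D) {K L : 𝓔}
    (h : (K : Set (Euc n)) ⊆ L) : (D K : Set (Euc n)) ≤ᵐ[volume] (D L : Set (Euc n)) :=
  hmono K L h.eventuallyLE

theorem RespectsCylinders.ae_le_preimage {H : Submodule ℝ (Euc n)} (hcyl : RespectsCylinders H D)
    {K : 𝓔} (hr : 0 < r) (hK : (K : Set (Euc n)) ⊆ H.starProjection ⁻¹' closedBall x r) :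
    (D K : Set (Euc n)) ≤ᵐ[volume] H.starProjection ⁻¹' closedBall x r := by
  have := hcyl K x r hr
  rw [inter_add_orthogonal_eq_preimage] at this
  exact this hK.eventuallyLE

/-- `D` carries `B(x + tu, r)` to `B(x + su, r)`, up to null sets. This is the relation that a
shift function `φ` turns into `s = φ t`; it holds vacuously if the first ball is not in `𝓔`. -/
def ShiftsBall (u : Euc n) (D : 𝓔 → finiteMeasureSets n) (x : Euc n) (r t s : ℝ) : Prop :=
  ∀ K : 𝓔, (K : Set (Euc n)) = closedBall (x + t • u) r →
    (D K : Set (Euc n)) =ᵐ[volume] closedBall (x + s • u) r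

theorem IsShiftFunction.shiftsBall {φ : ℝ → ℝ} (hφ : IsShiftFunction u D φ)
    (hx : x ∈ hyperplane u) (hr : 0 < r) (t : ℝ) : ShiftsBall u D x r t (φ t) :=
  fun K hK => hφ.2 K x t r hx hr hK

theorem exists_shiftsBall [Nontrivial (Euc n)] (hmeas : IsMeasurePreserving D)
    (hcyl : RespectsCylinders (hyperplane u) D) (hball : MapsBallsToBalls D)
    (hx : x ∈ hyperplane u) (hr : 0 < r) (t : ℝ) : ∃ s, ShiftsBall u D x r t s := by
  by_cases hB : closedBall (x + t • u) r ∈ 𝓔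
  swap
  · exact ⟨0, fun K hK => absurd (hK ▸ K.2) hB⟩
  obtain ⟨c, r', hr', hc⟩ := hball ⟨_, hB⟩ (x + t • u) r hr (ae_eq_refl _)
  obtain rfl : r' = r := radius_eq_of_addHaar_closedBall_eq hr'.le hr.le
    ((measure_congr hc).symm.trans (hmeas ⟨_, hB⟩))
  have hproj : closedBall (x + t • u) r' ⊆ (hyperplane u).starProjection ⁻¹' closedBall x r' := by
    intro z hz
    have := (hyperplane u).lipschitzWith_starProjection.dist_le_mul z (x + t • u)
    rw [starProjection_add_smul hx, NNReal.coe_one, one_mul] at this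
    exact this.trans hz
  have hcH : (hyperplane u).starProjection c = x :=
    starProjection_eq_of_closedBall_subset_preimage hx hr.le <|
      closedBall_subset_of_ae_le hr
        (isClosed_closedBall.preimage (hyperplane u).starProjection.continuous)
        (hc.symm.le.trans (hcyl.ae_le_preimage hr hproj))
  obtain ⟨y, hy, s, rfl⟩ := exists_eq_add_smul u c
  rw [starProjection_add_smul hy] at hcH
  subst hcH
  exact ⟨s, fun K hK => by rwa [show K = ⟨_, hB⟩ from Subtype.ext hK]⟩

theorem ShiftsBall.unique (h𝓔 : convexBodies n ⊆ 𝓔) (hu : ‖u‖ = 1) (hr : 0 < r)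
    (hs : ShiftsBall u D x r t s) (hs' : ShiftsBall u D x r t s') : s = s' := by
  have hB := h𝓔 (closedBall_mem_convexBodies (x + t • u) hr)
  have hdist := dist_le_sub_of_closedBall_ae_le hr le_rfl
    ((hs ⟨_, hB⟩ rfl).symm.trans (hs' ⟨_, hB⟩ rfl)).le
  have hcentre : x + s • u = x + s' • u := by simpa using hdist
  have hu0 : u ≠ 0 := norm_ne_zero_iff.1 (by simp [hu])
  exact smul_left_injective ℝ hu0 (add_left_cancel hcentre)

theorem ShiftsBall.dist_le (h𝓔 : convexBodies n ⊆ 𝓔) (hmono : IsMonotonic D) (hr : 0 < r)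
    (hrR : r ≤ R) (hs : ShiftsBall u D x r t s) (hs' : ShiftsBall u D y R t' s')
    (h : dist (x + t • u) (y + t' • u) ≤ R - r) : dist (x + s • u) (y + s' • u) ≤ R - r := by
  have hBr := h𝓔 (closedBall_mem_convexBodies (x + t • u) hr)
  have hBR := h𝓔 (closedBall_mem_convexBodies (y + t' • u) (hr.trans_le hrR))
  have hD := hmono.ae_le_of_subset (K := ⟨_, hBr⟩) (L := ⟨_, hBR⟩)
    (closedBall_subset_closedBall' (by linarith))
  exact dist_le_sub_of_closedBall_ae_le hr hrR
    (((hs ⟨_, hBr⟩ rfl).symm.le.trans hD).trans (hs' ⟨_, hBR⟩ rfl).le)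

theorem ShiftsBall.eq_of_dist_eq (h𝓔 : convexBodies n ⊆ 𝓔) (hmono : IsMonotonic D)
    (hu : ‖u‖ = 1) (hx : x ∈ hyperplane u) (hy : y ∈ hyperplane u) (hr : 0 < r)
    (hs : ShiftsBall u D x r t s) (hs' : ShiftsBall u D y R t s') (h : dist x y = R - r) :
    s = s' := by
  have hdist := hs.dist_le h𝓔 hmono hr (by linarith [dist_nonneg (x := x) (y := y)]) hs'
    (by rw [dist_add_right, h])
  have hsplit : x + s • u - (y + s' • u) = (x - y) + (s - s') • u := by module
  have hsq := pow_le_pow_left₀ dist_nonneg hdist 2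
  rw [← h, dist_eq_norm, dist_eq_norm, hsplit, norm_sq_add_smul hu (sub_mem hx hy)] at hsq
  have hzero : (s - s') ^ 2 = 0 := le_antisymm (by linarith) (sq_nonneg _)
  exact sub_eq_zero.1 (pow_eq_zero_iff two_ne_zero |>.1 hzero)

variable (hn : 2 ≤ n) (hu : ‖u‖ = 1) (h𝓔 : convexBodies n ⊆ 𝓔) (hmono : IsMonotonic D)
  (hex : ∀ x ∈ hyperplane u, ∀ r > 0, ∀ t, ∃ s, ShiftsBall u D x r t s)

include hn hu h𝓔 hmono hex

theorem ShiftsBall.eq_of_radius_lt (hx : x ∈ hyperplane u) (hr : 0 < r) (hrR : r < R)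
    (hs : ShiftsBall u D x r t s) (hs' : ShiftsBall u D x R t s') : s = s' := by
  obtain ⟨v, hv, hvnorm⟩ := exists_mem_orthogonal_singleton_norm_eq
    (by rw [finrank_euclideanSpace_fin]; exact hn) u (c := (R - r) / 2) (by linarith)
  have hxv : x + v ∈ hyperplane u := add_mem hx hv
  obtain ⟨s'', hs''⟩ := hex (x + v) hxv ((r + R) / 2) (by linarith) t
  calc s = s'' := hs.eq_of_dist_eq h𝓔 hmono hu hx hxv hr hs'' (by
        rw [dist_self_add_right, hvnorm]; ring)
    _ = s' := hs''.eq_of_dist_eq h𝓔 hmono hu hxv hx (by linarith) hs' (by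
        rw [dist_self_add_left, hvnorm]; ring)

theorem ShiftsBall.eq (hx : x ∈ hyperplane u) (hy : y ∈ hyperplane u) (hr : 0 < r) (hR : 0 < R)
    (hs : ShiftsBall u D x r t s) (hs' : ShiftsBall u D y R t s') : s = s' := by
  have hr' : 0 < r + dist x y := by positivity
  obtain ⟨s'', hs''⟩ := hex y hy (r + dist x y) hr' t
  obtain rfl : s = s'' := hs.eq_of_dist_eq h𝓔 hmono hu hx hy hr hs'' (by ring)
  rcases lt_trichotomy (r + dist x y) R with hlt | heq | hgt
  · exact hs''.eq_of_radius_lt hn hu h𝓔 hmono hex hy hr' hlt hs'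
  · exact hs''.unique h𝓔 hu hr' (heq ▸ hs')
  · exact (hs'.eq_of_radius_lt hn hu h𝓔 hmono hex hy hR hgt hs'').symm

theorem existsUnique_isShiftFunction : ∃! φ : ℝ → ℝ, IsShiftFunction u D φ := by
  have h0 : (0 : Euc n) ∈ hyperplane u := zero_mem _
  choose φ hφ using hex 0 h0 1 one_pos
  have hφ_ball {x r} (hx : x ∈ hyperplane u) (hr : 0 < r) (t) : ShiftsBall u D x r t (φ t) := by
    obtain ⟨s, hs⟩ := hex x hx r hr t
    rwa [hs.eq hn hu h𝓔 hmono hex hx h0 hr one_pos (hφ t)] at hs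
  have hdist (a b : ℝ) : dist (0 + a • u) (0 + b • u) = dist a b := by
    rw [dist_add_left, dist_eq_norm, ← sub_smul, norm_smul, hu, mul_one, dist_eq_norm]
  refine ⟨φ, ⟨.of_dist_le_mul fun s t => ?_, fun K x t r hx hr => hφ_ball hx hr t K⟩, ?_⟩
  · have hR : 0 < 1 + dist s t := by positivity
    have := (hφ s).dist_le h𝓔 hmono one_pos (by simp) (hφ_ball h0 hR t)
      (by rw [hdist, add_sub_cancel_left])
    rw [hdist, add_sub_cancel_left] at this
    rwa [NNReal.coe_one, one_mul]
  · exact fun ψ hψ => funext fun t => (hψ.shiftsBall h0 one_pos t).unique h𝓔 hu one_pos (hφ t)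

end ShiftFunction

section SolidCylinder

variable {E : Type*} [NormedAddCommGroup E] [InnerProductSpace ℝ E] {u x : E} {m δ h R : ℝ}

/-- The solid cylinder of radius `δ` and half-height `h` around the axis `x + ℝu`, centred at
`x + mu`; it is meant for a unit vector `u` and `x ∈ u^⊥`. -/
def solidCylinder (u x : E) (m δ h : ℝ) : Set E :=
  (ℝ ∙ u)ᗮ.starProjection ⁻¹' closedBall x δ ∩ innerSL ℝ u ⁻¹' closedBall m h

theorem add_smul_mem_solidCylinder_iff (hu : ‖u‖ = 1) {y : E} (hy : y ∈ (ℝ ∙ u)ᗮ) {t : ℝ} :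
    y + t • u ∈ solidCylinder u x m δ h ↔ dist y x ≤ δ ∧ dist t m ≤ h := by
  rw [solidCylinder, mem_inter_iff, mem_preimage, mem_preimage, starProjection_add_smul hy,
    innerSL_apply_apply, inner_add_smul hu hy, mem_closedBall, mem_closedBall]

theorem isClosed_solidCylinder : IsClosed (solidCylinder u x m δ h) :=
  (isClosed_closedBall.preimage (ContinuousLinearMap.continuous _)).inter
    (isClosed_closedBall.preimage (ContinuousLinearMap.continuous _))

theorem convex_solidCylinder : Convex ℝ (solidCylinder u x m δ h) :=
  ((convex_closedBall x δ).linear_preimage (ℝ ∙ u)ᗮ.starProjection.toLinearMap).inter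
    ((convex_closedBall m h).linear_preimage (innerSL ℝ u).toLinearMap)

theorem dist_sq_add_smul (hu : ‖u‖ = 1) (hx : x ∈ (ℝ ∙ u)ᗮ) {y : E} (hy : y ∈ (ℝ ∙ u)ᗮ)
    (t m : ℝ) : dist (y + t • u) (x + m • u) ^ 2 = dist y x ^ 2 + dist t m ^ 2 := by
  have hsplit : y + t • u - (x + m • u) = (y - x) + (t - m) • u := by module
  rw [dist_eq_norm, hsplit, norm_sq_add_smul hu (sub_mem hy hx), dist_eq_norm, Real.dist_eq,
    sq_abs]

theorem solidCylinder_subset_closedBall (hu : ‖u‖ = 1) (hx : x ∈ (ℝ ∙ u)ᗮ) (hR : 0 ≤ R)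
    (hδhR : δ ^ 2 + h ^ 2 ≤ R ^ 2) : solidCylinder u x m δ h ⊆ closedBall (x + m • u) R := by
  intro z hz
  obtain ⟨y, hy, t, rfl⟩ := exists_eq_add_smul u z
  obtain ⟨hyx, htm⟩ := (add_smul_mem_solidCylinder_iff hu hy).1 hz
  refine (pow_le_pow_iff_left₀ dist_nonneg hR two_ne_zero).1 ?_
  rw [dist_sq_add_smul hu hx hy]
  exact (add_le_add (pow_le_pow_left₀ dist_nonneg hyx 2)
    (pow_le_pow_left₀ dist_nonneg htm 2)).trans hδhR

theorem closedBall_subset_solidCylinder (hu : ‖u‖ = 1) (hx : x ∈ (ℝ ∙ u)ᗮ) {t : ℝ}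
    (ht : dist t m + δ ≤ h) : closedBall (x + t • u) δ ⊆ solidCylinder u x m δ h := by
  intro z hz
  obtain ⟨y, hy, s, rfl⟩ := exists_eq_add_smul u z
  have hsq := dist_sq_add_smul hu hx hy s t
  have hyx : dist y x ≤ δ :=
    (pow_le_pow_iff_left₀ dist_nonneg dist_nonneg two_ne_zero |>.1
      (by linarith [sq_nonneg (dist s t)])).trans (mem_closedBall.1 hz)
  have hst : dist s t ≤ δ :=
    (pow_le_pow_iff_left₀ dist_nonneg dist_nonneg two_ne_zero |>.1
      (by linarith [sq_nonneg (dist y x)])).trans (mem_closedBall.1 hz)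
  exact (add_smul_mem_solidCylinder_iff hu hy).2
    ⟨hyx, by linarith [dist_triangle s t m]⟩

theorem solidCylinder_mem_convexBodies {n : ℕ} {u x : Euc n} (hu : ‖u‖ = 1)
    (hx : x ∈ hyperplane u) (m : ℝ) (hδ : 0 < δ) (hh : 0 < h) :
    solidCylinder u x m δ h ∈ convexBodies n := by
  have hball : closedBall (x + m • u) (min δ h) ⊆ solidCylinder u x m δ h := by
    refine (closedBall_subset_solidCylinder hu hx (m := m) (h := min δ h) (by simp)).trans ?_
    exact inter_subset_inter (preimage_mono (closedBall_subset_closedBall (min_le_left _ _)))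
      (preimage_mono (closedBall_subset_closedBall (min_le_right _ _)))
  have hinterior : (interior (solidCylinder u x m δ h)).Nonempty :=
    ⟨x + m • u, interior_mono hball <|
      ball_subset_interior_closedBall (mem_ball_self (lt_min hδ hh))⟩
  have hbdd : solidCylinder u x m δ h ⊆ closedBall (x + m • u) (δ + h) :=
    solidCylinder_subset_closedBall hu hx (by positivity) (by nlinarith)
  exact ⟨⟨hinterior.mono interior_subset,
    (isCompact_closedBall _ _).of_isClosed_subset isClosed_solidCylinder hbdd,
    convex_solidCylinder⟩, hinterior⟩

theorem exists_solidCylinder_subset (hu : ‖u‖ = 1) {U : Set E} (hU : IsOpen U)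
    (hseg : ∀ τ ∈ closedBall m h, x + τ • u ∈ U) :
    ∃ ε > 0, ∀ δ ≤ ε, solidCylinder u x m δ h ⊆ U := by
  have hcompact : IsCompact ((fun τ : ℝ => x + τ • u) '' closedBall m h) :=
    (isCompact_closedBall m h).image (by fun_prop)
  obtain ⟨ε, hε, hsub⟩ := hcompact.exists_cthickening_subset_open hU (image_subset_iff.2 hseg)
  refine ⟨ε, hε, fun δ hδ z hz => hsub ?_⟩
  obtain ⟨y, hy, t, rfl⟩ := exists_eq_add_smul u z
  obtain ⟨hyx, htm⟩ := (add_smul_mem_solidCylinder_iff hu hy).1 hz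
  exact mem_cthickening_of_dist_le _ _ _ _ (mem_image_of_mem _ (mem_closedBall.2 htm))
    (by rw [dist_add_right]; exact hyx.trans hδ)

theorem measure_solidCylinder_center [MeasurableSpace E] [MeasurableAdd E] (μ : Measure E)
    [μ.IsAddLeftInvariant] (hu : ‖u‖ = 1) (hx : x ∈ (ℝ ∙ u)ᗮ) (m δ h : ℝ) :
    μ (solidCylinder u x m δ h) = μ (solidCylinder u 0 0 δ h) := by
  rw [← measure_preimage_add μ (x + m • u)]
  congr 1
  ext z
  obtain ⟨y, hy, t, rfl⟩ := exists_eq_add_smul u z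
  have hsum : x + m • u + (y + t • u) = (x + y) + (m + t) • u := by module
  rw [mem_preimage, hsum, add_smul_mem_solidCylinder_iff hu (add_mem hx hy),
    add_smul_mem_solidCylinder_iff hu hy, dist_self_add_left, dist_self_add_left,
    dist_zero_right, dist_zero_right]

variable [MeasurableSpace E] [BorelSpace E] [FiniteDimensional ℝ E] (μ : Measure E)
  [μ.IsAddHaarMeasure]

theorem addHaar_solidCylinder_mul (hu : ‖u‖ = 1) (δ h : ℝ) {k : ℝ} (hk : 0 < k) :
    μ (solidCylinder u 0 0 δ (k * h)) = ENNReal.ofReal k * μ (solidCylinder u 0 0 δ h) := by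
  set stretch : E →ₗ[ℝ] E := LinearMap.transvection (innerₗ E u) ((k - 1) • u) with hstretch
  have hdet : LinearMap.det stretch = k := by
    rw [hstretch, LinearMap.transvection.det, map_smul, innerₗ_apply_apply,
      real_inner_self_eq_norm_sq, hu]
    simp
  have happly {y : E} (hy : y ∈ (ℝ ∙ u)ᗮ) (t : ℝ) : stretch (y + t • u) = y + (k * t) • u := by
    rw [hstretch, LinearMap.transvection.apply, innerₗ_apply_apply, inner_add_smul hu hy]
    module
  have hpreimage : stretch ⁻¹' solidCylinder u 0 0 δ (k * h) = solidCylinder u 0 0 δ h := by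
    ext z
    obtain ⟨y, hy, t, rfl⟩ := exists_eq_add_smul u z
    rw [mem_preimage, happly hy, add_smul_mem_solidCylinder_iff hu hy,
      add_smul_mem_solidCylinder_iff hu hy, dist_zero_right, dist_zero_right (k * t),
      dist_zero_right t, norm_mul, Real.norm_of_nonneg hk.le, mul_le_mul_iff_right₀ hk]
  rw [← hpreimage, Measure.addHaar_preimage_linearMap μ (by rw [hdet]; exact hk.ne'), hdet,
    abs_of_pos (inv_pos.2 hk), ← mul_assoc, ← ENNReal.ofReal_mul hk.le, mul_inv_cancel₀ hk.ne',
    ENNReal.ofReal_one, one_mul]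

theorem addHaar_solidCylinder (hu : ‖u‖ = 1) (hx : x ∈ (ℝ ∙ u)ᗮ) (m : ℝ) (hδ : 0 < δ)
    (hh : 0 < h) : μ (solidCylinder u x m δ h) =
      ENNReal.ofReal (h / δ) * μ (solidCylinder u 0 0 δ δ) := by
  rw [measure_solidCylinder_center μ hu hx, ← addHaar_solidCylinder_mul μ hu δ δ (by positivity),
    div_mul_cancel₀ h hδ.ne']

end SolidCylinder

section Density

theorem ae_le_of_tendsto_measure_sdiff {E : Type*} [MetricSpace E] [MeasurableSpace E]
    [BorelSpace E] [SecondCountableTopology E] [HasBesicovitchCovering E] {μ : Measure E}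
    [IsLocallyFiniteMeasure μ] {G A : Set E} (hG : NullMeasurableSet G μ)
    (hA : NullMeasurableSet A μ)
    (h : ∀ y ∈ G, Tendsto (fun δ => μ (closedBall y δ \ A) / μ (closedBall y δ))
      (𝓝[>] 0) (𝓝 0)) : G ≤ᵐ[μ] A := by
  rw [ae_le_set, ← Measure.restrict_eq_zero, ← ae_eq_bot, ← eventually_false_iff_eq_bot]
  filter_upwards [Besicovitch.ae_tendsto_measure_inter_div μ (G \ A),
    ae_restrict_mem₀ (NullMeasurableSet.diff hG hA)] with y hy hyN
  have hle (δ : ℝ) : μ ((G \ A) ∩ closedBall y δ) / μ (closedBall y δ) ≤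
      μ (closedBall y δ \ A) / μ (closedBall y δ) :=
    ENNReal.div_le_div_right (measure_mono (subset_sdiff.2 ⟨inter_subset_right,
      disjoint_sdiff_left.mono_left inter_subset_left⟩)) _
  exact zero_ne_one (tendsto_nhds_unique
    (tendsto_of_tendsto_of_tendsto_of_le_of_le tendsto_const_nhds (h y hyN.1)
      (fun _ => zero_le) hle) hy)

variable {n : ℕ} {u x : Euc n} {𝓔 : Set (Set (Euc n))} {D : 𝓔 → finiteMeasureSets n}
  {φ : ℝ → ℝ} {m δ h R t : ℝ}

theorem image_solidCylinder_ae_le (hu : ‖u‖ = 1) (h𝓔 : convexBodies n ⊆ 𝓔)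
    (hmono : IsMonotonic D) (hcyl : RespectsCylinders (hyperplane u) D)
    (hφ : IsShiftFunction u D φ) (hx : x ∈ hyperplane u) (hδ : 0 < δ) (hR : 0 < R)
    (hδhR : δ ^ 2 + h ^ 2 ≤ R ^ 2) (L : 𝓔) (hL : (L : Set (Euc n)) = solidCylinder u x m δ h) :
    (D L : Set (Euc n)) ≤ᵐ[volume] solidCylinder u x (φ m) δ R := by
  have hB := h𝓔 (closedBall_mem_convexBodies (x + m • u) hR)
  have hcylinder := hcyl.ae_le_preimage (K := L) hδ (hL.trans_subset inter_subset_left)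
  have hball := (hmono.ae_le_of_subset (K := L) (L := ⟨_, hB⟩)
    (hL.trans_subset (solidCylinder_subset_closedBall hu hx hR.le hδhR))).trans
      (hφ.shiftsBall hx hR m ⟨_, hB⟩ rfl).le
  filter_upwards [hcylinder, hball] with z hz_cylinder hz_ball hz
  have hz_proj : dist ((hyperplane u).starProjection z) x ≤ δ := hz_cylinder hz
  have hz_dist : dist z (x + φ m • u) ≤ R := hz_ball hz
  obtain ⟨y, hy, t, rfl⟩ := exists_eq_add_smul u z
  rw [starProjection_add_smul hy] at hz_proj
  refine (add_smul_mem_solidCylinder_iff hu hy).2 ⟨hz_proj, ?_⟩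
  refine (pow_le_pow_iff_left₀ dist_nonneg dist_nonneg two_ne_zero |>.1 ?_).trans hz_dist
  linarith [dist_sq_add_smul hu hx hy t (φ m), sq_nonneg (dist y x)]

theorem volume_solidCylinder_sdiff_image (hu : ‖u‖ = 1) (hmeas : IsMeasurePreserving D)
    (hx : x ∈ hyperplane u) (hδ : 0 < δ) (hh : 0 < h) (hhR : h ≤ R) (L : 𝓔)
    (hL : (L : Set (Euc n)) = solidCylinder u x m δ h)
    (hDL : (D L : Set (Euc n)) ≤ᵐ[volume] solidCylinder u x t δ R) :
    volume (solidCylinder u x t δ R \ (D L : Set (Euc n))) =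
      ENNReal.ofReal ((R - h) / δ) * volume (solidCylinder u 0 0 δ δ) := by
  have hDL_volume : volume (solidCylinder u x t δ R ∩ (D L : Set (Euc n))) =
      ENNReal.ofReal (h / δ) * volume (solidCylinder u 0 0 δ δ) := by
    rw [← addHaar_solidCylinder volume hu hx m hδ hh, ← hL, ← hmeas L]
    exact measure_congr (inter_eventuallyEq_right.2 hDL)
  have hfinite : volume (solidCylinder u (0 : Euc n) 0 δ δ) ≠ ⊤ :=
    (solidCylinder_mem_convexBodies hu (zero_mem _) 0 hδ hδ).1.2.1.measure_lt_top.ne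
  have hsplit := measure_inter_add_sdiff₀ (solidCylinder u x t δ R) (D L).2.1
  rw [hDL_volume, addHaar_solidCylinder volume hu hx t hδ (hh.trans_le hhR),
    ← add_sub_cancel h R, add_div, ENNReal.ofReal_add (by positivity)
      (div_nonneg (sub_nonneg.2 hhR) hδ.le), add_mul] at hsplit
  rw [add_sub_cancel] at hsplit
  exact (ENNReal.add_right_inj (ENNReal.mul_ne_top ENNReal.ofReal_ne_top hfinite)).1 hsplit

/-- The points reached when the segments of `U` parallel to `u` are translated along `u` so that
the height `m` of the midpoint becomes `φ m`. -/
def shiftedSegments (u : Euc n) (φ : ℝ → ℝ) (U : Set (Euc n)) : Set (Euc n) :=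
  {y | ∃ x ∈ hyperplane u, ∃ m h : ℝ, (∀ τ ∈ closedBall m h, x + τ • u ∈ U) ∧
    ∃ t ∈ ball (φ m) h, x + t • u = y}

variable (hu : ‖u‖ = 1) (h𝓔 : convexBodies n ⊆ 𝓔) (hmono : IsMonotonic D)
  (hmeas : IsMeasurePreserving D) (hcyl : RespectsCylinders (hyperplane u) D)
  (hφ : IsShiftFunction u D φ) {K : 𝓔}

include hu h𝓔 hmono hmeas hcyl hφ

theorem volume_closedBall_sdiff_image_le (hx : x ∈ hyperplane u) (hδ : 0 < δ)
    (hK : solidCylinder u x m δ h ⊆ K) (ht : dist t (φ m) + δ ≤ h) :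
    volume (closedBall (x + t • u) δ \ (D K : Set (Euc n))) ≤
      ENNReal.ofReal (δ / (2 * h)) * volume (closedBall (0 : Euc n) (2 * δ)) := by
  have hh : 0 < h := by linarith [dist_nonneg (x := t) (y := φ m)]
  -- `R - h` is the first-order term of `√(δ² + h²) - h`, which is all that the density estimate
  -- needs, and it keeps `R` rational in `δ` and `h`.
  set R := h + δ ^ 2 / (2 * h) with hR_def
  have hhR : h ≤ R := le_add_of_nonneg_right (by positivity)
  have hR_sq : R ^ 2 = δ ^ 2 + h ^ 2 + (δ ^ 2 / (2 * h)) ^ 2 := by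
    rw [hR_def]; field_simp; ring
  have hL := h𝓔 (solidCylinder_mem_convexBodies hu hx m hδ hh)
  have hDL := image_solidCylinder_ae_le hu h𝓔 hmono hcyl hφ hx hδ (hh.trans_le hhR)
    (by rw [hR_sq]; exact le_add_of_nonneg_right (sq_nonneg _)) ⟨_, hL⟩ rfl
  have hDK := hmono.ae_le_of_subset (K := ⟨_, hL⟩) (L := K) hK
  have hexcess : (R - h) / δ = δ / (2 * h) := by
    rw [hR_def, add_sub_cancel_left]; field_simp
  calc volume (closedBall (x + t • u) δ \ (D K : Set (Euc n)))
      ≤ volume (solidCylinder u x (φ m) δ R \ (D ⟨_, hL⟩ : Set (Euc n))) :=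
        measure_mono_ae <|
          (closedBall_subset_solidCylinder hu hx (ht.trans hhR)).eventuallyLE.diff hDK
    _ = ENNReal.ofReal (δ / (2 * h)) * volume (solidCylinder u 0 0 δ δ) := by
        rw [volume_solidCylinder_sdiff_image hu hmeas hx hδ hh hhR ⟨_, hL⟩ rfl hDL, hexcess]
    _ ≤ _ := by
        gcongr
        simpa using solidCylinder_subset_closedBall (m := 0) hu (zero_mem _)
          (by positivity : 0 ≤ 2 * δ) (by nlinarith)

theorem tendsto_volume_closedBall_sdiff_image {y : Euc n}
    (hy : y ∈ shiftedSegments u φ (interior (K : Set (Euc n)))) :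
    Tendsto (fun δ => volume (closedBall y δ \ (D K : Set (Euc n))) / volume (closedBall y δ))
      (𝓝[>] 0) (𝓝 0) := by
  obtain ⟨x, hx, m, h, hseg, t, ht, rfl⟩ := hy
  obtain ⟨ε, hε, hsub⟩ := exists_solidCylinder_subset hu isOpen_interior hseg
  have hbound : ∀ᶠ δ in 𝓝[>] (0 : ℝ),
      volume (closedBall (x + t • u) δ \ (D K : Set (Euc n))) / volume (closedBall (x + t • u) δ)
        ≤ ENNReal.ofReal (δ / (2 * h)) * ENNReal.ofReal (2 ^ n) := by
    have hsmall : ∀ᶠ δ in 𝓝[>] (0 : ℝ), δ < min ε (h - dist t (φ m)) :=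
      mem_nhdsWithin_of_mem_nhds (Iio_mem_nhds (lt_min hε (sub_pos.2 ht)))
    filter_upwards [hsmall, self_mem_nhdsWithin] with δ hδlt hδ
    obtain ⟨hδε, hδh⟩ := lt_min_iff.1 hδlt
    have hdouble : volume (closedBall (0 : Euc n) (2 * δ)) =
        ENNReal.ofReal (2 ^ n) * volume (closedBall (x + t • u) δ) := by
      rw [Measure.addHaar_closedBall_mul volume 0 zero_le_two (le_of_lt hδ),
        finrank_euclideanSpace_fin, Measure.addHaar_closedBall_center volume (x + t • u)]
    refine ENNReal.div_le_of_le_mul ?_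
    rw [mul_assoc, ← hdouble]
    exact volume_closedBall_sdiff_image_le hu h𝓔 hmono hmeas hcyl hφ hx hδ
      ((hsub δ hδε.le).trans interior_subset) (by linarith)
  have hlim : Tendsto (fun δ => ENNReal.ofReal (δ / (2 * h)) * ENNReal.ofReal (2 ^ n))
      (𝓝[>] 0) (𝓝 0) := by
    have hcont : Continuous fun δ : ℝ => δ / (2 * h) := by fun_prop
    have := ENNReal.Tendsto.mul_const (ENNReal.tendsto_ofReal (hcont.tendsto 0))
      (Or.inr (ENNReal.ofReal_ne_top (r := 2 ^ n)))
    simpa using this.mono_left nhdsWithin_le_nhds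
  exact tendsto_of_tendsto_of_tendsto_of_le_of_le' tendsto_const_nhds hlim
    (Eventually.of_forall fun _ => zero_le) hbound

theorem image_ae_eq_of_subset_shiftedSegments {G : Set (Euc n)} (hG : NullMeasurableSet G volume)
    (hKG : volume (K : Set (Euc n)) ≤ volume G)
    (hseg : G ⊆ shiftedSegments u φ (interior (K : Set (Euc n)))) :
    (D K : Set (Euc n)) =ᵐ[volume] G :=
  (ae_eq_of_ae_subset_of_measure_ge
    (ae_le_of_tendsto_measure_sdiff hG (D K).2.1 fun _ hy =>
      tendsto_volume_closedBall_sdiff_image hu h𝓔 hmono hmeas hcyl hφ (hseg hy))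
    ((hmeas K).trans_le hKG) hG (D K).2.2.ne).symm

end Density

section SetMaps

variable {n : ℕ} {u : Euc n} {A B : Set (Euc n)}

theorem reflectSet_eq_preimage (H : Submodule ℝ (Euc n)) (A : Set (Euc n)) :
    reflectSet H A = H.reflection ⁻¹' A := by
  rw [reflectSet, LinearIsometryEquiv.image_eq_preimage_symm, reflection_symm]

theorem reflectSet_congr_ae (H : Submodule ℝ (Euc n)) (h : A =ᵐ[volume] B) :
    reflectSet H A =ᵐ[volume] reflectSet H B := by
  rw [reflectSet_eq_preimage, reflectSet_eq_preimage]
  exact H.reflection.measurePreserving.quasiMeasurePreserving.preimage_ae_eq h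

theorem measurableSet_reflectSet (H : Submodule ℝ (Euc n)) (hA : MeasurableSet A) :
    MeasurableSet (reflectSet H A) := by
  rw [reflectSet_eq_preimage]
  exact H.reflection.continuous.measurable hA

theorem volume_reflectSet (H : Submodule ℝ (Euc n)) (A : Set (Euc n)) :
    volume (reflectSet H A) = volume A := by
  rw [reflectSet_eq_preimage]
  exact H.reflection.measurePreserving.measure_preimage_emb
    H.reflection.toMeasurableEquiv.measurableEmbedding A

theorem reflectSet_closedBall_smul (u : Euc n) (t r : ℝ) :
    reflectSet (hyperplane u) (closedBall (t • u) r) = closedBall ((-t) • u) r := by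
  rw [reflectSet, LinearIsometryEquiv.image_closedBall, map_smul,
    reflection_orthogonalComplement_singleton_eq_neg, smul_neg, neg_smul]

theorem polarizeSet_eq_union (u : Euc n) (A : Set (Euc n)) :
    polarizeSet u A = A ∩ reflectSet (hyperplane u) A ∪
      (A ∪ reflectSet (hyperplane u) A) ∩ {z | 0 ≤ ⟪u, z⟫} := by
  classical
  ext z
  rw [reflectSet_eq_preimage]
  simp only [polarizeSet, polarize, mem_ofPred_eq, indicator_apply, mem_union, mem_inter_iff,
    mem_preimage]
  by_cases hz : 0 ≤ ⟪u, z⟫ <;> by_cases hzA : z ∈ A <;>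
    by_cases hzA' : (hyperplane u).reflection z ∈ A <;> simp [hz, hzA, hzA']

theorem polarizeSet_congr_ae (u : Euc n) (h : A =ᵐ[volume] B) :
    polarizeSet u A =ᵐ[volume] polarizeSet u B := by
  have h' := reflectSet_congr_ae (hyperplane u) h
  rw [polarizeSet_eq_union, polarizeSet_eq_union]
  exact (h.inter h').union ((h.union h').inter (ae_eq_refl _))

theorem measurableSet_polarizeSet (u : Euc n) (hA : MeasurableSet A) :
    MeasurableSet (polarizeSet u A) := by
  have hA' := measurableSet_reflectSet (hyperplane u) hA
  have hhalf : MeasurableSet {z : Euc n | 0 ≤ ⟪u, z⟫} :=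
    measurableSet_le measurable_const (by fun_prop)
  rw [polarizeSet_eq_union]
  exact (hA.inter hA').union ((hA.union hA').inter hhalf)

theorem volume_le_volume_polarizeSet (u : Euc n) (hA : MeasurableSet A) :
    volume A ≤ volume (polarizeSet u A) := by
  have hswap : reflectSet (hyperplane u) (A \ polarizeSet u A) ⊆ polarizeSet u A \ A := by
    rw [polarizeSet_eq_union, reflectSet_eq_preimage, reflectSet_eq_preimage]
    rintro z ⟨hz, hz'⟩
    have hzA : z ∉ A := fun hzA => hz' <| Or.inl ⟨hz, by rwa [mem_preimage, reflection_reflection]⟩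
    have hneg : ⟪u, (hyperplane u).reflection z⟫ < 0 :=
      not_le.1 fun hpos => hz' <| Or.inr ⟨Or.inl hz, hpos⟩
    rw [inner_reflection, neg_lt_zero] at hneg
    exact ⟨Or.inr ⟨Or.inr hz, hneg.le⟩, hzA⟩
  calc volume A = volume (A ∩ polarizeSet u A) + volume (A \ polarizeSet u A) :=
        (measure_inter_add_sdiff A (measurableSet_polarizeSet u hA)).symm
    _ ≤ volume (polarizeSet u A ∩ A) + volume (polarizeSet u A \ A) := by
        rw [inter_comm, ← volume_reflectSet (hyperplane u) (A \ polarizeSet u A)]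
        gcongr
    _ = volume (polarizeSet u A) := measure_inter_add_sdiff _ hA

theorem dist_smul_le_dist_neg_smul {z : Euc n} {t : ℝ} (h : 0 ≤ t * ⟪u, z⟫) :
    dist z (t • u) ≤ dist z ((-t) • u) := by
  refine pow_le_pow_iff_left₀ dist_nonneg dist_nonneg two_ne_zero |>.1 ?_
  rw [dist_eq_norm, dist_eq_norm, norm_sub_sq_real, norm_sub_sq_real, inner_smul_right,
    inner_smul_right, norm_smul, norm_smul, norm_neg, real_inner_comm]
  linarith

theorem polarizeSet_closedBall_smul_of_nonneg (u : Euc n) {t : ℝ} (ht : 0 ≤ t) (r : ℝ) :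
    polarizeSet u (closedBall (t • u) r) = closedBall (t • u) r := by
  rw [polarizeSet_eq_union, reflectSet_closedBall_smul]
  refine Subset.antisymm (union_subset inter_subset_left ?_) fun z hz => ?_
  · rintro z ⟨hz | hz, hz0⟩
    · exact hz
    · exact (dist_smul_le_dist_neg_smul (mul_nonneg ht hz0)).trans hz
  · rcases le_total 0 ⟪u, z⟫ with hz0 | hz0
    · exact Or.inr ⟨Or.inl hz, hz0⟩
    · have hdist := dist_smul_le_dist_neg_smul
        (mul_nonneg_of_nonpos_of_nonpos (neg_nonpos.2 ht) hz0)
      rw [neg_neg] at hdist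
      exact Or.inl ⟨hz, hdist.trans hz⟩

theorem polarizeSet_closedBall_smul (u : Euc n) (t r : ℝ) :
    polarizeSet u (closedBall (t • u) r) = closedBall (|t| • u) r := by
  have hsymm : polarizeSet u (closedBall (t • u) r) = polarizeSet u (closedBall (|t| • u) r) := by
    rcases abs_choice t with h | h <;> rw [h]
    rw [polarizeSet_eq_union, polarizeSet_eq_union, reflectSet_closedBall_smul,
      reflectSet_closedBall_smul, neg_neg, inter_comm (closedBall (t • u) r),
      union_comm (closedBall (t • u) r)]
  rw [hsymm, polarizeSet_closedBall_smul_of_nonneg u (abs_nonneg t)]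

end SetMaps

section Segments

variable {n : ℕ} {u x : Euc n} {U : Set (Euc n)} {φ : ℝ → ℝ} {t : ℝ}

theorem add_smul_mem_shiftedSegments (hU : IsOpen U) (hx : x ∈ hyperplane u)
    (ht : x + t • u ∈ U) : x + φ t • u ∈ shiftedSegments u φ U := by
  have hV : IsOpen ((fun τ : ℝ => x + τ • u) ⁻¹' U) := hU.preimage (by fun_prop)
  obtain ⟨h, hh, hsub⟩ := nhds_basis_closedBall.mem_iff.1 (hV.mem_nhds ht)
  exact ⟨x, hx, t, h, hsub, φ t, mem_ball_self hh, rfl⟩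

theorem add_smul_mem_shiftedSegments_of_symm (hU : IsOpen U) (hconv : Convex ℝ U)
    (hφ : φ 0 = 0) (hx : x ∈ hyperplane u) (ht : x + t • u ∈ U) (ht' : x + (-t) • u ∈ U) :
    x + t • u ∈ shiftedSegments u φ U := by
  set V := (fun τ : ℝ => x + τ • u) ⁻¹' U
  have hV : IsOpen V := hU.preimage (by fun_prop)
  have hVconv : Convex ℝ V :=
    (hconv.translate_preimage_right x).linear_preimage (LinearMap.toSpanSingleton ℝ (Euc n) u)
  have hsub : closedBall 0 |t| ⊆ V := by
    rw [Real.closedBall_eq_Icc, zero_sub, zero_add]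
    rcases abs_choice t with h | h <;> rw [h]
    · exact hVconv.ordConnected.out ht' ht
    · rw [neg_neg]
      exact hVconv.ordConnected.out ht ht'
  obtain ⟨ε, hε, hsubε⟩ := (isCompact_closedBall 0 |t|).exists_cthickening_subset_open hV hsub
  rw [cthickening_closedBall hε.le (abs_nonneg t)] at hsubε
  exact ⟨x, hx, 0, ε + |t|, hsubε, t, by simpa [hφ] using hε, rfl⟩

/-- `F` is a set map to be compared with the maps `D` of shift function `ψ`: it is compatible with
null sets and does not decrease volume, it acts by `ψ` on the balls centred on `ℝu`, and it puts
no point of the image of an open convex set outside the `ψ`-shifted segments. -/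
structure MovesSegments (u : Euc n) (ψ : ℝ → ℝ) (F : Set (Euc n) → Set (Euc n)) : Prop where
  congr_ae : ∀ {A B : Set (Euc n)}, A =ᵐ[volume] B → F A =ᵐ[volume] F B
  measurableSet : ∀ {A : Set (Euc n)}, MeasurableSet A → MeasurableSet (F A)
  volume_le : ∀ {A : Set (Euc n)}, MeasurableSet A → volume A ≤ volume (F A)
  map_closedBall : ∀ t r : ℝ, F (closedBall (t • u) r) = closedBall (ψ t • u) r
  subset_shiftedSegments :
    ∀ {U : Set (Euc n)}, IsOpen U → Convex ℝ U → F U ⊆ shiftedSegments u ψ U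

theorem movesSegments_id (u : Euc n) : MovesSegments u (fun t => t) id where
  congr_ae h := h
  measurableSet hA := hA
  volume_le _ := le_rfl
  map_closedBall _ _ := rfl
  subset_shiftedSegments hU _ y hy := by
    obtain ⟨x, hx, t, rfl⟩ := exists_eq_add_smul u y
    exact add_smul_mem_shiftedSegments hU hx hy

theorem movesSegments_polarizeSet (hu : ‖u‖ = 1) :
    MovesSegments u (fun t => |t|) (polarizeSet u) where
  congr_ae := polarizeSet_congr_ae u
  measurableSet := measurableSet_polarizeSet u
  volume_le := volume_le_volume_polarizeSet u
  map_closedBall := polarizeSet_closedBall_smul u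
  subset_shiftedSegments {U} hU hconv y hy := by
    obtain ⟨x, hx, t, rfl⟩ := exists_eq_add_smul u y
    rw [polarizeSet_eq_union, reflectSet_eq_preimage] at hy
    rcases hy with ⟨ht, ht'⟩ | ⟨ht | ht', ht0⟩
    · rw [mem_preimage, reflection_add_smul hx] at ht'
      exact add_smul_mem_shiftedSegments_of_symm hU hconv abs_zero hx ht ht'
    all_goals rw [mem_ofPred_eq, inner_add_smul hu hx] at ht0
    · simpa [abs_of_nonneg ht0] using add_smul_mem_shiftedSegments (φ := fun t => |t|) hU hx ht
    · rw [mem_preimage, reflection_add_smul hx] at ht'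
      simpa [abs_of_nonneg ht0] using add_smul_mem_shiftedSegments (φ := fun t => |t|) hU hx ht'

theorem MovesSegments.reflectSet_comp {ψ : ℝ → ℝ} {F : Set (Euc n) → Set (Euc n)}
    (hF : MovesSegments u ψ F) :
    MovesSegments u (fun t => -ψ t) (fun A => reflectSet (hyperplane u) (F A)) where
  congr_ae h := reflectSet_congr_ae _ (hF.congr_ae h)
  measurableSet hA := measurableSet_reflectSet _ (hF.measurableSet hA)
  volume_le hA := (hF.volume_le hA).trans_eq (volume_reflectSet _ _).symm
  map_closedBall t r := by rw [hF.map_closedBall, reflectSet_closedBall_smul]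
  subset_shiftedSegments hU hconv := by
    rintro _ ⟨y, hy, rfl⟩
    obtain ⟨x, hx, m, h, hseg, t, ht, rfl⟩ := hF.subset_shiftedSegments hU hconv hy
    exact ⟨x, hx, m, h, hseg, -t, by rwa [mem_ball, dist_neg_neg], (reflection_add_smul hx t).symm⟩

end Segments

section Characterization

variable {n : ℕ} {u : Euc n} {𝓔 : Set (Set (Euc n))} {D : 𝓔 → finiteMeasureSets n}

theorem MovesSegments.forall_eq_iff_essentiallyEquals {φ ψ : ℝ → ℝ}
    {F : Set (Euc n) → Set (Euc n)} (hF : MovesSegments u ψ F) (hu : ‖u‖ = 1)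
    (h𝓔 : convexBodies n ⊆ 𝓔) (hconv : ∀ K ∈ 𝓔, Convex ℝ K) (hmono : IsMonotonic D)
    (hmeas : IsMeasurePreserving D) (hcyl : RespectsCylinders (hyperplane u) D)
    (hφ : IsShiftFunction u D φ) : (∀ t, φ t = ψ t) ↔ EssentiallyEquals D F := by
  constructor
  · intro hφψ K
    obtain rfl : φ = ψ := funext hφψ
    have hinterior : interior (K : Set (Euc n)) =ᵐ[volume] (K : Set (Euc n)) :=
      interior_ae_eq_of_null_frontier ((hconv K K.2).addHaar_frontier volume)
    have hvolume := hF.volume_le (isOpen_interior (s := (K : Set (Euc n)))).measurableSet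
    rw [measure_congr hinterior] at hvolume
    exact (image_ae_eq_of_subset_shiftedSegments hu h𝓔 hmono hmeas hcyl hφ
      (hF.measurableSet isOpen_interior.measurableSet).nullMeasurableSet hvolume
      (hF.subset_shiftedSegments isOpen_interior (hconv K K.2).interior)).trans
        (hF.congr_ae hinterior)
  · intro hDF t
    have hψ : ShiftsBall u D 0 1 t (ψ t) := fun K hK => by
      rw [zero_add] at hK ⊢
      simpa only [hK, hF.map_closedBall] using hDF K
    exact (hφ.shiftsBall (zero_mem _) one_pos t).unique h𝓔 hu one_pos hψ

end Characterization

end Polarization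

open Polarization in
theorem mainTheorem9_general (n : ℕ) (hn : 2 ≤ n) (u : Euc n) (hu : ‖u‖ = 1)
    (𝓔 : Set (Set (Euc n))) (h𝓔 : convexBodies n ⊆ 𝓔) (hconv : ∀ K ∈ 𝓔, Convex ℝ K)
    (D : 𝓔 → finiteMeasureSets n) (hmono : IsMonotonic D) (hmeas : IsMeasurePreserving D)
    (hcyl : RespectsCylinders (hyperplane u) D) (hball : MapsBallsToBalls D) :
    (∃! φ : ℝ → ℝ, IsShiftFunction u D φ) ∧
    ∀ φ : ℝ → ℝ, IsShiftFunction u D φ →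
      ((∀ t, φ t = t) ↔ EssentiallyEquals D id) ∧
      ((∀ t, φ t = -t) ↔ EssentiallyEquals D (reflectSet (hyperplane u))) ∧
      ((∀ t, φ t = |t|) ↔ EssentiallyEquals D (polarizeSet u)) ∧
      ((∀ t, φ t = -|t|) ↔
        EssentiallyEquals D (fun K => reflectSet (hyperplane u) (polarizeSet u K))) := by
  have : Nontrivial (Euc n) :=
    Module.nontrivial_of_finrank_pos (R := ℝ) (by rw [finrank_euclideanSpace_fin]; omega)
  refine ⟨existsUnique_isShiftFunction hn hu h𝓔 hmono fun x hx r hr t =>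
    exists_shiftsBall hmeas hcyl hball hx hr t, fun φ hφ => ?_⟩
  have hid := movesSegments_id u
  have hpol := movesSegments_polarizeSet hu
  exact ⟨hid.forall_eq_iff_essentiallyEquals hu h𝓔 hconv hmono hmeas hcyl hφ,
    hid.reflectSet_comp.forall_eq_iff_essentiallyEquals hu h𝓔 hconv hmono hmeas hcyl hφ,
    hpol.forall_eq_iff_essentiallyEquals hu h𝓔 hconv hmono hmeas hcyl hφ,
    hpol.reflectSet_comp.forall_eq_iff_essentiallyEquals hu h𝓔 hconv hmono hmeas hcyl hφ⟩

theorem mainTheorem9 (n : ℕ) (hn : 2 ≤ n)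
    (u : Polarization.Euc n) (hu : ‖u‖ = 1)
    (𝓔 : Set (Set (Polarization.Euc n)))
    (h𝓔 : 𝓔 = Polarization.convexBodies n ∨ 𝓔 = Polarization.compactConvexSets n)
    (D : 𝓔 → Polarization.finiteMeasureSets n)
    (hmono : Polarization.IsMonotonic D)
    (hmeas : Polarization.IsMeasurePreserving D)
    (hcyl : Polarization.RespectsCylinders (Polarization.hyperplane u) D)
    (hball : Polarization.MapsBallsToBalls D) :
    (∃! φ : ℝ → ℝ, Polarization.IsShiftFunction u D φ) ∧
    ∀ φ : ℝ → ℝ, Polarization.IsShiftFunction u D φ →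
      ((∀ t, φ t = t) ↔ Polarization.EssentiallyEquals D id) ∧
      ((∀ t, φ t = -t) ↔
        Polarization.EssentiallyEquals D
          (Polarization.reflectSet (Polarization.hyperplane u))) ∧
      ((∀ t, φ t = |t|) ↔ Polarization.EssentiallyEquals D (Polarization.polarizeSet u)) ∧
      ((∀ t, φ t = -|t|) ↔
        Polarization.EssentiallyEquals D
          (fun K => Polarization.reflectSet (Polarization.hyperplane u)
            (Polarization.polarizeSet u K))) := by
  rcases h𝓔 with rfl | rfl
  · exact mainTheorem9_general n hn u hu _ subset_rfl (fun K hK => hK.1.2.2) D hmono hmeas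
      hcyl hball
  · exact mainTheorem9_general n hn u hu _ (fun K hK => hK.1) (fun K hK => hK.2.2) D hmono hmeas
      hcyl hball
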